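/- \textbf{Theorem.} The problem \textsc{Cube Similarity (2-d)} is \textsc{Graph Isomorphism}-complete. Here an instance of \textsc{Cube Similarity (2-d)} is a pair of $0$-$1$ matrices $(A,A')$ (two-dimensional allocation cubes), and it is a yes-instance if $A$ and $A'$ have the same shape $m\times n$ and there are permutations $\gamma_1$ of $\{1,\ldots,m\}$ and $\gamma_2$ of $\{1,\ldots,n\}$ such that $A'_{i,j}=A_{\gamma_1(i),\gamma_2(j)}$ for all $i,j$; that is, $A$ and $A'$ can be made equal by permuting rows and columns independently. An instance of \textsc{Graph Isomorphism} is a pair of finite simple graphs, and it is a yes-instance if the two graphs are isomorphic. Matrices are encoded by their dimensions in unary followed by their entries, row by row, and graphs are encoded by their adjacency matrices. A problem $\Pi$ is \textsc{Graph Isomorphism}-complete if there are a polynomial-time many-one reduction from $\Pi$ to \textsc{Graph Isomorphism} and a polynomial-time many-one reduction from \textsc{Graph Isomorphism} to $\Pi$, where polynomial time refers to Turing machines. The same holds for the restriction of \textsc{Cube Similarity (2-d)} to pairs of square matrices (regular cubes). -/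

import Mathlib

/-! ### Decision problems and polynomial-time many-one reductions -/

/-- A decision problem: a type of instances, an injective encoding of the instances as words over
a finite alphabet, and the set of yes-instances. -/
structure DecisionProblem where
  /-- the instances -/
  Instance : Type
  /-- the alphabet in which instances are written -/
  Symbol : Type
  /-- the alphabet is finite -/
  finite_symbol : Finite Symbol
  /-- the word by which an instance is presented to a machine -/
  encode : Instance → List Symbol
  /-- distinct instances have distinct words -/
  encode_injective : Function.Injective encode
  /-- the yes-instances -/
  IsYes : Instance → Prop

namespace DecisionProblem

/-- The restriction of a decision problem to a set of instances, with the same encoding. -/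
def restrict (P : DecisionProblem) (S : Set P.Instance) : DecisionProblem where
  Instance := {x : P.Instance // x ∈ S}
  Symbol := P.Symbol
  finite_symbol := P.finite_symbol
  encode x := P.encode x.1
  encode_injective := fun _ _ h => Subtype.ext (P.encode_injective h)
  IsYes x := P.IsYes x.1

/-- `P.PolyTimeReducible Q`: there is a polynomial-time many-one reduction from `P` to `Q`, that
is, a map from instances of `P` to instances of `Q` which preserves and reflects yes-instances and
is computed by a (multi-stack) Turing machine in time polynomial in the length of the input word. -/
def PolyTimeReducible (P Q : DecisionProblem) : Prop :=
  ∃ f : P.Instance → Q.Instance, (∀ x, P.IsYes x ↔ Q.IsYes (f x)) ∧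
    Nonempty (Turing.TM2ComputableInPolyTime P.encode Q.encode f)

end DecisionProblem

/-! ### Two-dimensional cubes -/

/-- A two-dimensional allocation cube: a 0-1 matrix (`true` stands for 1, an allocated cell). -/
structure Cube2 where
  /-- number of rows -/
  rows : ℕ
  /-- number of columns -/
  cols : ℕ
  /-- the entries -/
  entry : Matrix (Fin rows) (Fin cols) Bool

namespace Cube2

/-- A cube is regular if it has the same number of attribute values in both dimensions. -/
def IsRegular (C : Cube2) : Prop :=
  C.rows = C.cols

/-- `C.Similar D`: permuting the rows of `C` by some `γ₁` and, independently, its columns by some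
`γ₂` yields `D`. The two bijections exist only if `C` and `D` have the same shape, in which case
they are permutations of the row indices and of the column indices. -/
def Similar (C D : Cube2) : Prop :=
  ∃ (γ₁ : Fin D.rows ≃ Fin C.rows) (γ₂ : Fin D.cols ≃ Fin C.cols),
    C.entry.submatrix γ₁ γ₂ = D.entry

/-- A row is written as its bits followed by the separator `none`. -/
def encodeRow {n : ℕ} (r : Fin n → Bool) : List (Option Bool) :=
  (List.ofFn r).map some ++ [none]

/-- A 0-1 matrix is written as its number of rows and its number of columns in unary, each followed
by the separator `none`, and then its rows from top to bottom. -/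
def encode (C : Cube2) : List (Option Bool) :=
  List.replicate C.rows (some true) ++ none ::
    (List.replicate C.cols (some true) ++ none ::
      (List.ofFn fun i => encodeRow (C.entry i)).flatten)

theorem replicate_none_cancel {a b : ℕ} {s t : List (Option Bool)}
    (h : List.replicate a (some true) ++ none :: s = List.replicate b (some true) ++ none :: t) :
    a = b ∧ s = t := by
  induction a generalizing b with
  | zero => cases b <;> simp_all [List.replicate_succ]
  | succ a ih =>
    cases b with
    | zero => simp [List.replicate_succ] at h
    | succ b =>
      simp only [List.replicate_succ, List.cons_append, List.cons.injEq, true_and] at h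
      exact ⟨congrArg (· + 1) (ih h).1, (ih h).2⟩

theorem encodeRow_cancel {n : ℕ} {r r' : Fin n → Bool} {s t : List (Option Bool)}
    (h : encodeRow r ++ s = encodeRow r' ++ t) : r = r' ∧ s = t := by
  obtain ⟨h1, h2⟩ := List.append_inj h (by simp [encodeRow])
  refine ⟨List.ofFn_injective ?_, h2⟩
  exact List.map_injective_iff.2 (Option.some_injective _) (List.append_cancel_right h1)

theorem rows_cancel {m n : ℕ} {A B : Fin m → Fin n → Bool} {s t : List (Option Bool)}
    (h : (List.ofFn fun i => encodeRow (A i)).flatten ++ s =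
      (List.ofFn fun i => encodeRow (B i)).flatten ++ t) : A = B ∧ s = t := by
  induction m with
  | zero => exact ⟨funext fun i => i.elim0, by simpa using h⟩
  | succ m ih =>
    simp only [List.ofFn_succ, List.flatten_cons, List.append_assoc] at h
    obtain ⟨h0, h1⟩ := encodeRow_cancel h
    obtain ⟨h2, h3⟩ := ih h1
    exact ⟨funext fun i => Fin.cases h0 (fun j => congrFun h2 j) i, h3⟩

/-- The encoding of matrices is self-delimiting. -/
theorem encode_cancel {C D : Cube2} {s t : List (Option Bool)}
    (h : C.encode ++ s = D.encode ++ t) : C = D ∧ s = t := by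
  obtain ⟨m, n, A⟩ := C
  obtain ⟨m', n', B⟩ := D
  simp only [encode, List.append_assoc, List.cons_append] at h
  obtain ⟨rfl, h⟩ := replicate_none_cancel h
  obtain ⟨rfl, h⟩ := replicate_none_cancel h
  obtain ⟨hAB, hst⟩ := rows_cancel h
  exact ⟨congrArg (Cube2.mk m n) hAB, hst⟩

end Cube2

/-- Cube Similarity (2-d): given two 0-1 matrices (encoded one after the other), are they
similar? -/
def cubeSimilarity2 : DecisionProblem where
  Instance := Cube2 × Cube2
  Symbol := Option Bool
  finite_symbol := inferInstance
  encode x := x.1.encode ++ x.2.encode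
  encode_injective := by
    rintro ⟨C, D⟩ ⟨C', D'⟩ h
    obtain ⟨rfl, h'⟩ := Cube2.encode_cancel h
    obtain ⟨rfl, -⟩ := Cube2.encode_cancel (s := []) (t := []) (by simpa using h')
    rfl
  IsYes x := x.1.Similar x.2

/-- Cube Similarity (2-d) restricted to regular cubes, that is, to square 0-1 matrices. -/
def regularCubeSimilarity2 : DecisionProblem :=
  cubeSimilarity2.restrict {x : Cube2 × Cube2 | x.1.IsRegular ∧ x.2.IsRegular}

/-! ### Graph isomorphism -/

/-- A finite simple graph on the vertices `0, …, order - 1`. -/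
structure FiniteGraph where
  /-- number of vertices -/
  order : ℕ
  /-- the graph -/
  graph : SimpleGraph (Fin order)

namespace FiniteGraph

open Classical in
/-- The adjacency matrix of a graph, as a 0-1 matrix. -/
noncomputable def adjacency (G : FiniteGraph) : Cube2 where
  rows := G.order
  cols := G.order
  entry := Matrix.of fun i j => decide (G.graph.Adj i j)

theorem adjacency_injective : Function.Injective adjacency := by
  rintro ⟨n, G⟩ ⟨m, H⟩ h
  simp only [adjacency, Cube2.mk.injEq] at h
  obtain ⟨rfl, -, h⟩ := h
  have h' := eq_of_heq h
  congr 1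
  ext i j
  simpa using congrFun (congrFun h' i) j

end FiniteGraph

/-- Graph Isomorphism: given two finite simple graphs (encoded one after the other by their
adjacency matrices), are they isomorphic? -/
noncomputable def graphIsomorphism : DecisionProblem where
  Instance := FiniteGraph × FiniteGraph
  Symbol := Option Bool
  finite_symbol := inferInstance
  encode x := x.1.adjacency.encode ++ x.2.adjacency.encode
  encode_injective := by
    rintro ⟨G, H⟩ ⟨G', H'⟩ h
    have h' := cubeSimilarity2.encode_injective
      (a₁ := (G.adjacency, H.adjacency)) (a₂ := (G'.adjacency, H'.adjacency)) h
    have h1 := FiniteGraph.adjacency_injective (congrArg Prod.fst h')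
    have h2 := FiniteGraph.adjacency_injective (congrArg Prod.snd h')
    rw [h1, h2]
  IsYes x := Nonempty (x.1.graph ≃g x.2.graph)

/-- A problem is Graph Isomorphism-complete if it has a polynomial-time many-one reduction to
Graph Isomorphism and Graph Isomorphism has one to it. -/
def GraphIsomorphismComplete (P : DecisionProblem) : Prop :=
  P.PolyTimeReducible graphIsomorphism ∧ graphIsomorphism.PolyTimeReducible P

/-! ### A structured language for stack machines -/

/-! Both reductions add gadgets that force every isomorphism or similarity to respect blocks. A
matrix becomes the bipartite graph on its rows and columns together with a triangle, one of whose
vertices is joined to every row. Only the three added vertices lie in triangles, and the rows are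
the remaining vertices with a neighbour among them, so an isomorphism restricts to a bijection of
rows and a bijection of columns (`exists_submatrix_iff_nonempty_iso`).

A graph with adjacency matrix `A` becomes the square matrix with block rows `(A, I, 1)`, `(I, I,
0)`, `(1, 0, 0)`, where the last block has two indices. The repeated rows and columns are exactly
the last block, and their ones single out the first block. The identity blocks then force the row
and column permutations to agree, so that they come from one relabelling of the vertices
(`exists_relabelling_iff_exists_submatrix`). The result is always square, so the same map serves
regular cubes.

For the time bounds, both maps are written in a small structured language whose compiled code needs
no more steps than the recorded bound (`Runs.exists_iterate`). Since matrix codes are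
self-delimiting, a program for one matrix is run twice to treat a pair, and a final move reverses
the output (`nonempty_computable_of_rewrites`). -/

/-- Structured programs acting on finitely many stacks indexed by `K` with symbols from `Γ`. -/
inductive StackProg (K Γ : Type) : Type
  /-- do nothing -/
  | skip : StackProg K Γ
  /-- push a symbol -/
  | push (k : K) (a : Γ) : StackProg K Γ
  /-- run one program after another -/
  | seq (p q : StackProg K Γ) : StackProg K Γ
  /-- repeatedly pop a stack, leave the loop if the outcome satisfies `isExit`, and otherwise run the
  body belonging to the outcome -/
  | loop (k : K) (isExit : Option Γ → Bool) (body : Option Γ → StackProg K Γ) : StackProg K Γ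

namespace StackProg

variable {K Γ : Type}

/-- The control points of a program. -/
def Label : StackProg K Γ → Type
  | skip => Unit
  | push _ _ => Unit
  | seq p q => p.Label ⊕ q.Label
  -- `none` is the head of the loop. Every outcome of the pop has its own copy of the body, so the
  -- popped symbol is remembered by the control point.
  | loop _ _ body => Option (Σ o, (body o).Label)

theorem finite_label [Finite Γ] (p : StackProg K Γ) : Finite p.Label := by
  induction p with
  | skip => exact inferInstanceAs (Finite Unit)
  | push k a => exact inferInstanceAs (Finite Unit)
  | seq p q ihp ihq => exact inferInstanceAs (Finite (p.Label ⊕ q.Label))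
  | loop k isExit body ih => exact inferInstanceAs (Finite (Option (Σ o, (body o).Label)))

/-- The control point at which a program starts. -/
def entry : (p : StackProg K Γ) → p.Label
  | skip => ()
  | push _ _ => ()
  | seq p _ => Sum.inl p.entry
  | loop _ _ _ => (none : Option _)

/-- The code of a program at its control points, where the control points are named by `ι` and
control is passed to `exit` at the end. The internal state holds the outcome of the last `pop`. -/
def code {Λ : Type} : (p : StackProg K Γ) → (p.Label → Λ) → Λ → p.Label →
    Turing.TM2.Stmt (fun _ : K => Γ) Λ (Option Γ)
  | skip, _, exit, _ => .goto fun _ => exit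
  | push k a, _, exit, _ => .push k (fun _ => a) (.goto fun _ => exit)
  | seq p q, ι, exit, l =>
    match l with
    | Sum.inl l => p.code (fun l => ι (Sum.inl l)) (ι (Sum.inr q.entry)) l
    | Sum.inr l => q.code (fun l => ι (Sum.inr l)) exit l
  | loop k isExit body, ι, exit, l =>
    match l with
    | none => .pop k (fun _ o => o)
        (.goto fun v => if isExit v then exit else ι (some ⟨v, (body v).entry⟩))
    | some ⟨o, l⟩ => (body o).code (fun l => ι (some ⟨o, l⟩)) (ι none) l

variable [DecidableEq K]

/-- `Runs p S S' t`: started with stacks `S`, the program `p` ends with stacks `S'` after at most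
`t` steps. -/
inductive Runs : StackProg K Γ → (K → List Γ) → (K → List Γ) → ℕ → Prop
  | skip (S) : Runs skip S S 1
  | push (k a S) : Runs (push k a) S (Function.update S k (a :: S k)) 1
  | seq {p q S S₁ S₂ t₁ t₂} : Runs p S S₁ t₁ → Runs q S₁ S₂ t₂ → Runs (seq p q) S S₂ (t₁ + t₂)
  | loop_exit {k isExit body S} : isExit (S k).head? = true →
      Runs (loop k isExit body) S (Function.update S k (S k).tail) 1
  | loop_step {k isExit body S S₁ S₂ t₁ t₂} : isExit (S k).head? = false →
      Runs (body (S k).head?) (Function.update S k (S k).tail) S₁ t₁ →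
      Runs (loop k isExit body) S₁ S₂ t₂ → Runs (loop k isExit body) S S₂ (t₁ + t₂ + 1)
  | mono {p S S' t t'} : Runs p S S' t → t ≤ t' → Runs p S S' t'

/-- Compiled code simulates the program. -/
theorem Runs.exists_iterate {p : StackProg K Γ} {S S' : K → List Γ} {t : ℕ} (h : Runs p S S' t)
    {Λ : Type} (M : Λ → Turing.TM2.Stmt (fun _ : K => Γ) Λ (Option Γ)) (ι : p.Label → Λ)
    (exit : Λ) (hM : ∀ l, M (ι l) = p.code ι exit l) (v : Option Γ) :
    ∃ v' n, n ≤ t ∧ (flip bind (Turing.TM2.step M))^[n]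
      (some (⟨some (ι p.entry), v, S⟩ : Turing.TM2.Cfg (fun _ : K => Γ) Λ (Option Γ))) =
      some ⟨some exit, v', S'⟩ := by
  -- Subprograms run inside the same machine under another naming and with another exit, and the
  -- first part of a sequence leaves an unknown register value; hence the generalization.
  induction h generalizing Λ v with
  | skip S =>
    refine ⟨v, 1, le_rfl, ?_⟩
    simp [flip, hM, code]
  | push k a S =>
    refine ⟨v, 1, le_rfl, ?_⟩
    simp [flip, hM, code]
  | @seq p q S S₁ S₂ t₁ t₂ _ _ ih₁ ih₂ =>
    obtain ⟨v₁, n₁, hn₁, h₁⟩ := ih₁ M (fun l => ι (Sum.inl l)) (ι (Sum.inr q.entry))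
      (fun l => hM (Sum.inl l)) v
    obtain ⟨v₂, n₂, hn₂, h₂⟩ := ih₂ M (fun l => ι (Sum.inr l)) exit
      (fun l => hM (Sum.inr l)) v₁
    refine ⟨v₂, n₂ + n₁, by omega, ?_⟩
    rw [Function.iterate_add_apply]
    exact (congrArg _ h₁).trans h₂
  | @loop_exit k isExit body S hs =>
    refine ⟨(S k).head?, 1, le_rfl, ?_⟩
    have : M (ι (entry (loop k isExit body))) = _ := hM none
    simp [flip, this, code, hs]
  | @loop_step k isExit body S S₁ S₂ t₁ t₂ hs _ _ ih₁ ih₂ =>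
    obtain ⟨v₁, n₁, hn₁, h₁⟩ := ih₁ M (fun l => ι (some ⟨_, l⟩)) (ι none)
      (fun l => hM (some ⟨_, l⟩)) (S k).head?
    obtain ⟨v₂, n₂, hn₂, h₂⟩ := ih₂ M ι exit hM v₁
    refine ⟨v₂, n₂ + (n₁ + 1), by omega, ?_⟩
    have : M (ι (entry (loop k isExit body))) = _ := hM none
    rw [Function.iterate_add_apply, Function.iterate_succ_apply]
    refine Eq.trans (congrArg _ ?_) h₂
    refine Eq.trans (congrArg _ ?_) h₁
    simp [flip, this, code, hs]
  | mono _ hle ih =>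
    obtain ⟨v', n, hn, h⟩ := ih M ι exit hM v
    exact ⟨v', n, hn.trans hle, h⟩

/-- The machine that runs a program and then halts; its input and its output are on stack `k₀`. -/
noncomputable def toFinTM2 [Fintype K] [Fintype Γ] (p : StackProg K Γ) (k₀ : K) : Turing.FinTM2 :=
  haveI := p.finite_label
  letI : Fintype p.Label := Fintype.ofFinite _
  { K := K
    k₀ := k₀
    k₁ := k₀
    Γ := fun _ => Γ
    Λ := Option p.Label
    main := some p.entry
    σ := Option Γ
    initialState := none
    Γk₀Fin := inferInstanceAs (Fintype Γ)
    m := fun l => match l with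
      -- `haltList` demands the initial register value, so the outcome of the last pop is erased
      -- before halting.
      | none => .load (fun _ => none) .halt
      | some l => p.code some none l }

/-- The left side is the form in which `initList` and `haltList` present their stacks; the cast
disappears because all stacks share one alphabet. -/
theorem dite_cast_eq_update (k₀ : K) (w : List Γ) (k : K) :
    (if h : k = k₀ then (by rw [h]; exact w : List ((fun _ : K => Γ) k)) else []) =
      Function.update (fun _ => []) k₀ w k := by
  by_cases hk : k = k₀
  · subst hk; simp
  · simp [hk]

section

variable [Fintype K] [Fintype Γ]

theorem initList_toFinTM2 (p : StackProg K Γ) (k₀ : K) (w : List Γ) :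
    Turing.initList (p.toFinTM2 k₀) w =
      (⟨some (some p.entry), none, Function.update (fun _ => []) k₀ w⟩ :
        Turing.TM2.Cfg (fun _ : K => Γ) (Option p.Label) (Option Γ)) :=
  congrArg (fun s => (⟨some (some p.entry), none, s⟩ :
    Turing.TM2.Cfg (fun _ : K => Γ) (Option p.Label) (Option Γ)))
    (funext (dite_cast_eq_update k₀ w))

theorem haltList_toFinTM2 (p : StackProg K Γ) (k₀ : K) (w : List Γ) :
    Turing.haltList (p.toFinTM2 k₀) w =
      (⟨none, none, Function.update (fun _ => []) k₀ w⟩ :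
        Turing.TM2.Cfg (fun _ : K => Γ) (Option p.Label) (Option Γ)) :=
  congrArg (fun s => (⟨none, none, s⟩ :
    Turing.TM2.Cfg (fun _ : K => Γ) (Option p.Label) (Option Γ)))
    (funext (dite_cast_eq_update k₀ w))

/-- A program with a polynomial time bound yields a polynomial-time computable function. -/
theorem nonempty_computableInPolyTime {α β : Type} {ea : α → List Γ}
    {eb : β → List Γ} {f : α → β} (p : StackProg K Γ) (k₀ : K) (time : Polynomial ℕ)
    (h : ∀ x, Runs p (Function.update (fun _ => []) k₀ (ea x))
      (Function.update (fun _ => []) k₀ (eb (f x))) (time.eval (ea x).length)) :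
    Nonempty (Turing.TM2ComputableInPolyTime ea eb f) := by
  refine ⟨{ tm := p.toFinTM2 k₀, inputAlphabet := Equiv.refl Γ, outputAlphabet := Equiv.refl Γ,
            time := time + 1, outputsFun := fun x => Nonempty.some ?_ }⟩
  obtain ⟨v, n, hn, hi⟩ := (h x).exists_iterate (p.toFinTM2 k₀).m some none (fun l => rfl) none
  have e₁ := initList_toFinTM2 p k₀ (ea x)
  have e₂ := haltList_toFinTM2 p k₀ (eb (f x))
  rw [← List.map_id (ea x)] at e₁
  rw [← List.map_id (eb (f x))] at e₂
  -- The step beyond the `n` steps of the program is the halting statement; it accounts for `time +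
  -- 1`.
  refine ⟨⟨⟨1 + n, ?_⟩, ?_⟩⟩
  · refine (congrArg (fun c => (flip bind (p.toFinTM2 k₀).step)^[1 + n] (some c)) e₁).trans ?_
    refine Eq.trans ?_ (congrArg some e₂).symm
    simp only [List.map_id]
    rw [Function.iterate_add_apply]
    refine (congrArg _ hi).trans ?_
    rfl
  · simp only [Polynomial.eval_add, Polynomial.eval_one]
    omega

end

end StackProg

/-! ### Basic stack programs and their running times -/

namespace StackProg

variable {K Γ : Type}

/-- Empty a stack. -/
def clear (k : K) : StackProg K Γ :=
  loop k Option.isNone fun _ => skip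

/-- Move a stack onto another one, symbol by symbol. -/
def move (k d : K) : StackProg K Γ :=
  loop k Option.isNone fun o => o.elim skip fun x => push d x

/-- Push `x` onto `d` once for every symbol on `c`, using the stack `t` to preserve `c`. -/
def emit (c t d : K) (x : Γ) : StackProg K Γ :=
  seq (loop c Option.isNone fun o => o.elim skip fun y => seq (push t y) (push d x)) (move t c)

/-- Push the symbols of a list, the first one first. -/
def pushList (k : K) : List Γ → StackProg K Γ
  | [] => skip
  | a :: l => seq (push k a) (pushList k l)

/-- Move the symbols up to the next separator, and drop the separator. -/
def moveRow (k d : K) : StackProg K (Option Γ) :=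
  loop k (fun o => o.join.isNone) fun o => o.elim skip fun x => push d x

/-- Move the symbols up to the next separator onto two stacks, and drop the separator. -/
def copyRow (k d e : K) : StackProg K (Option Γ) :=
  loop k (fun o => o.join.isNone) fun o => o.elim skip fun x => seq (push d x) (push e x)

variable [DecidableEq K]

open Function (update)

/-- Runs are composed with whatever stacks and times the rules produce; both are brought to the
desired form once, at the end. -/
theorem Runs.congr {p : StackProg K Γ} {S S' S'' : K → List Γ} {t t' : ℕ} (h : Runs p S S' t)
    (hS : S' = S'') (ht : t ≤ t') : Runs p S S'' t' :=
  hS ▸ h.mono ht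

/-- The rule for a loop that runs until a stack is empty, in the case that it is not. -/
theorem Runs.loop_cons {k : K} {body : Option Γ → StackProg K Γ} {S S₀ S₁ S₂ : K → List Γ} {x : Γ}
    {l : List Γ} {t₁ t₂ : ℕ} (hk : S k = x :: l) (hS : update S k l = S₀)
    (h₁ : Runs (body (some x)) S₀ S₁ t₁) (h₂ : Runs (loop k Option.isNone body) S₁ S₂ t₂) :
    Runs (loop k Option.isNone body) S S₂ (t₁ + t₂ + 1) :=
  Runs.loop_step (by simp [hk]) (by simpa [hk, hS] using h₁) h₂

theorem Runs.loop_nil {k : K} {body : Option Γ → StackProg K Γ} {S : K → List Γ} (hk : S k = []) :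
    Runs (loop k Option.isNone body) S S 1 := by
  have h := Runs.loop_exit (k := k) (isExit := Option.isNone) (body := body) (S := S) (by simp [hk])
  rwa [hk, List.tail_nil, ← hk, Function.update_eq_self] at h

/-- Each symbol costs one pop and one step of the body; the pop that finds the stack empty costs one
more. -/
theorem runs_clear (k : K) (S : K → List Γ) :
    Runs (clear k) S (update S k []) (2 * (S k).length + 1) := by
  induction hl : S k generalizing S with
  | nil => exact (Runs.loop_nil hl).congr (by rw [← hl, Function.update_eq_self]) (by simp)
  | cons x l ih =>
    refine (Runs.loop_cons hl rfl (.skip _) (ih _ (by simp))).congr (by simp) ?_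
    simp only [List.length_cons]; omega

theorem runs_move {k d : K} (hkd : k ≠ d) (S : K → List Γ) :
    Runs (move k d) S (update (update S k []) d ((S k).reverse ++ S d))
      (2 * (S k).length + 1) := by
  induction hl : S k generalizing S with
  | nil =>
    refine (Runs.loop_nil hl).congr ?_ (by simp)
    rw [← hl, Function.update_eq_self]; simp [hl]
  | cons x l ih =>
    refine (Runs.loop_cons hl rfl (.push _ _ _) (ih _ (by simp [hkd]))).congr ?_ ?_
    · funext j
      by_cases hj : j = d <;> by_cases hj' : j = k <;> simp_all [Function.update_apply]
    · simp only [List.length_cons]; omega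

/-- The loop reverses `c` onto `t` and the move reverses it back, so `c` is restored. Were `t` not
empty at the start, its old contents would end up on `c`. -/
theorem runs_emit {c t d : K} (hct : c ≠ t) (hcd : c ≠ d) (htd : t ≠ d) (x : Γ) (S : K → List Γ)
    (ht : S t = []) :
    Runs (emit c t d x) S (update S d (List.replicate (S c).length x ++ S d))
      (5 * (S c).length + 2) := by
  have key : ∀ (l : List Γ) (S : K → List Γ), S c = l →
      Runs (loop c Option.isNone fun o => o.elim skip fun y => seq (push t y) (push d x)) S
        (update (update (update S c []) t (l.reverse ++ S t)) d
          (List.replicate l.length x ++ S d)) (3 * l.length + 1) := by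
    intro l
    induction l with
    | nil =>
      intro S hl
      refine (Runs.loop_nil hl).congr ?_ (by simp)
      rw [← hl, Function.update_eq_self]; simp [hl]
    | cons y l ih =>
      intro S hl
      refine (Runs.loop_cons hl rfl (.seq (.push _ _ _) (.push _ _ _))
        (ih _ (by simp [hct, hcd]))).congr ?_ ?_
      · funext j
        have : ∀ (n : ℕ) (r : List Γ), List.replicate n x ++ x :: r =
            x :: (List.replicate n x ++ r) := fun n r => by
          rw [← List.singleton_append, ← List.append_assoc, ← List.replicate_succ',
            List.replicate_succ, List.cons_append]
        by_cases h1 : j = d <;> by_cases h2 : j = c <;> by_cases h3 : j = t <;>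
          simp_all [Function.update_apply, List.replicate_succ, Ne.symm htd, Ne.symm hcd]
      · simp only [List.length_cons]; omega
  refine (Runs.seq (key _ S rfl) (runs_move hct.symm _)).congr ?_ ?_
  · funext j
    by_cases h1 : j = d <;> by_cases h2 : j = c <;> by_cases h3 : j = t <;>
      simp_all
  · simp [ht, htd]; omega

theorem runs_pushList (k : K) (l : List Γ) (S : K → List Γ) :
    Runs (pushList k l) S (update S k (l.reverse ++ S k)) (l.length + 1) := by
  induction l generalizing S with
  | nil => exact (Runs.skip S).congr (by simp) (by simp)
  | cons a l ih =>
    refine (Runs.seq (.push _ _ _) (ih _)).congr (by simp) ?_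
    simp only [List.length_cons]; omega

/-- A separator is popped as `some none`, which `join` sends to `none`. The pop that ends the loop
is therefore the one that removes the separator. -/
theorem runs_moveRow {k d : K} (hkd : k ≠ d) (w : List Γ) (r : List (Option Γ))
    (S : K → List (Option Γ)) (hk : S k = w.map some ++ none :: r) :
    Runs (moveRow k d) S (update (update S k r) d ((w.map some).reverse ++ S d))
      (2 * w.length + 1) := by
  induction w generalizing S with
  | nil =>
    refine (Runs.loop_exit (by simp [hk])).congr ?_ (by simp)
    simp [hk, Function.update_comm hkd]
  | cons x w ih =>
    refine (Runs.loop_step (S₁ := update (update S k (w.map some ++ none :: r)) d (some x :: S d))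
      (t₁ := 1) (by simp [hk]) ?_ (ih _ (by simp [hkd]))).congr ?_ ?_
    · simp only [hk, List.map_cons, List.cons_append, List.head?_cons, Option.elim, List.tail_cons]
      exact (Runs.push _ _ _).congr (by simp [hkd.symm]) le_rfl
    · funext j
      by_cases hj : j = d <;> by_cases hj' : j = k <;> simp_all
    · simp only [List.length_cons]; omega

theorem runs_copyRow {k d e : K} (hkd : k ≠ d) (hke : k ≠ e) (hde : d ≠ e) (w : List Γ)
    (r : List (Option Γ)) (S : K → List (Option Γ)) (hk : S k = w.map some ++ none :: r) :
    Runs (copyRow k d e) S (update (update (update S k r) d ((w.map some).reverse ++ S d)) e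
      ((w.map some).reverse ++ S e)) (3 * w.length + 1) := by
  induction w generalizing S with
  | nil =>
    refine (Runs.loop_exit (by simp [hk])).congr ?_ (by simp)
    funext j
    by_cases h1 : j = d <;> by_cases h2 : j = k <;> by_cases h3 : j = e <;>
      simp_all [Function.update_apply]
  | cons x w ih =>
    refine (Runs.loop_step (S₁ := update (update (update S k (w.map some ++ none :: r)) d
      (some x :: S d)) e (some x :: S e))
      (t₁ := 2) (by simp [hk]) ?_ (ih _ (by simp [hkd, hke]))).congr ?_ ?_
    · simp only [hk, List.map_cons, List.cons_append, List.head?_cons, Option.elim, List.tail_cons]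
      exact (Runs.seq (.push _ _ _) (.push _ _ _)).congr
        (by simp [hkd.symm, hde.symm, hke.symm]) le_rfl
    · funext j
      by_cases h1 : j = d <;> by_cases h2 : j = k <;> by_cases h3 : j = e <;>
        simp_all [Function.update_apply]
    · simp only [List.length_cons]; omega

end StackProg

/-! ### The stacks of the machines and the reading of a matrix -/

/-- The stacks of the machines below: the input, the reversed output, two counters, the part of a
matrix that is still needed, and auxiliary stacks. -/
inductive Reg
  | inp | out | rows | cols | tmp | aux | mat | rev
  deriving DecidableEq

namespace Reg

instance : Fintype Reg :=
  ⟨{inp, out, rows, cols, tmp, aux, mat, rev}, fun k => by cases k <;> decide⟩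

/-- The stacks with the given contents. -/
def mk {Γ : Type} (i o a b t u s r : List Γ) : Reg → List Γ
  | inp => i
  | out => o
  | rows => a
  | cols => b
  | tmp => t
  | aux => u
  | mat => s
  | rev => r

section

variable {Γ : Type} (i o a b t u s r x : List Γ)

@[simp] theorem mk_inp : mk i o a b t u s r inp = i := rfl
@[simp] theorem mk_out : mk i o a b t u s r out = o := rfl
@[simp] theorem mk_rows : mk i o a b t u s r rows = a := rfl
@[simp] theorem mk_cols : mk i o a b t u s r cols = b := rfl
@[simp] theorem mk_tmp : mk i o a b t u s r tmp = t := rfl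
@[simp] theorem mk_aux : mk i o a b t u s r aux = u := rfl
@[simp] theorem mk_mat : mk i o a b t u s r mat = s := rfl
@[simp] theorem mk_rev : mk i o a b t u s r rev = r := rfl

-- With the stacks as an explicit tuple, symbolic execution is rewriting. `tmp` needs no such rule:
-- it serves only inside `emit`, which leaves it empty.
@[simp] theorem update_inp :
    Function.update (mk i o a b t u s r) inp x = mk x o a b t u s r := by
  funext k; cases k <;> rfl
@[simp] theorem update_out :
    Function.update (mk i o a b t u s r) out x = mk i x a b t u s r := by
  funext k; cases k <;> rfl
@[simp] theorem update_rows :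
    Function.update (mk i o a b t u s r) rows x = mk i o x b t u s r := by
  funext k; cases k <;> rfl
@[simp] theorem update_cols :
    Function.update (mk i o a b t u s r) cols x = mk i o a x t u s r := by
  funext k; cases k <;> rfl
@[simp] theorem update_aux :
    Function.update (mk i o a b t u s r) aux x = mk i o a b t x s r := by
  funext k; cases k <;> rfl
@[simp] theorem update_mat :
    Function.update (mk i o a b t u s r) mat x = mk i o a b t u x r := by
  funext k; cases k <;> rfl
@[simp] theorem update_rev :
    Function.update (mk i o a b t u s r) rev x = mk i o a b t u s x := by
  funext k; cases k <;> rfl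

theorem update_empty_inp :
    Function.update (fun _ => []) inp x = mk x [] [] [] [] [] [] [] := by
  funext k; cases k <;> rfl

end

end Reg

open StackProg Reg

/-- The rows of a matrix, one after the other. -/
def encodeRows {m n : ℕ} (A : Fin m → Fin n → Bool) : List (Option Bool) :=
  (List.ofFn fun i => Cube2.encodeRow (A i)).flatten

theorem length_encodeRows {m n : ℕ} (A : Fin m → Fin n → Bool) :
    (encodeRows A).length = m * (n + 1) := by
  simp [encodeRows, Cube2.encodeRow, List.length_flatten, Function.comp_def, List.map_ofFn]

/-- Exposes the first row in the shape that `moveRow` and `copyRow` consume. -/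
theorem encodeRows_succ {m n : ℕ} (A : Fin (m + 1) → Fin n → Bool) :
    encodeRows A = (List.ofFn (A 0)).map some ++ none :: encodeRows fun i => A i.succ := by
  simp [encodeRows, Cube2.encodeRow, List.ofFn_succ]

/-- Read the dimensions of a matrix. -/
def readDims : StackProg Reg (Option Bool) :=
  seq (moveRow inp rows) (moveRow inp cols)

theorem runs_readDims (m n : ℕ) (i o : List (Option Bool)) :
    Runs readDims (Reg.mk (List.replicate m (some true) ++ none ::
        (List.replicate n (some true) ++ none :: i)) o [] [] [] [] [] [])
      (Reg.mk i o (List.replicate m (some true)) (List.replicate n (some true)) [] [] [] [])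
      (2 * m + 2 * n + 2) := by
  have h₁ := runs_moveRow (k := inp) (d := rows) (by decide) (List.replicate m true)
    (List.replicate n (some true) ++ none :: i) (Reg.mk (List.replicate m (some true) ++ none ::
        (List.replicate n (some true) ++ none :: i)) o [] [] [] [] [] []) (by simp)
  simp only [Reg.update_inp, Reg.update_rows, Reg.mk_rows] at h₁
  refine (h₁.seq (runs_moveRow (k := inp) (d := cols) (by decide) (List.replicate n true) i _
    (by simp))).congr (by simp) ?_
  simp; omega

/-! ### From matrices to graphs -/

/-- Write and remove the first column of the stored matrix. -/
def peel : StackProg Reg (Option Bool) :=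
  seq (loop mat Option.isNone fun o => o.elim skip fun x =>
      seq (push out x) (seq (moveRow mat rev) (push rev none)))
    (move rev mat)

/-- Having `n + 1` columns ensures that the symbol popped at the start of each row is an entry and
not a separator. The stack `rev` collects the shortened matrix in reverse, separators included, so
one move restores it. -/
theorem runs_peel {m n : ℕ} (A : Fin m → Fin (n + 1) → Bool) (i o a b u : List (Option Bool)) :
    Runs peel (Reg.mk i o a b [] u (encodeRows A) [])
      (Reg.mk i ((List.ofFn fun i => some (A i 0)).reverse ++ o) a b [] u
        (encodeRows fun i j => A i j.succ) []) (m * (4 * n + 10) + 2) := by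
  have key : ∀ (m : ℕ) (A : Fin m → Fin (n + 1) → Bool) (o r : List (Option Bool)),
      Runs (loop mat Option.isNone fun o => o.elim skip fun x =>
          seq (push out x) (seq (moveRow mat rev) (push rev none)))
        (Reg.mk i o a b [] u (encodeRows A) r)
        (Reg.mk i ((List.ofFn fun i => some (A i 0)).reverse ++ o) a b [] u []
          ((encodeRows fun i j => A i j.succ).reverse ++ r)) (m * (2 * n + 8) + 1) := by
    intro m
    induction m with
    | zero => intro A o r; exact (Runs.loop_nil (by simp [encodeRows])).congr
                (by simp [encodeRows]) (by simp)
    | succ m ih =>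
      intro A o r
      have h₁ := runs_moveRow (k := mat) (d := rev) (by decide) (List.ofFn fun j => A 0 j.succ)
        (encodeRows fun i => A i.succ) (Reg.mk i (some (A 0 0) :: o) a b [] u
        ((List.ofFn fun j => A 0 j.succ).map some ++ none :: encodeRows fun i => A i.succ) r) rfl
      simp only [Reg.update_mat, Reg.update_rev, Reg.mk_rev] at h₁
      have h₂ := Runs.seq (Runs.push out (some (A 0 0)) (Reg.mk i o a b [] u
        ((List.ofFn fun j => A 0 j.succ).map some ++ none :: encodeRows fun i => A i.succ) r))
        (Runs.seq (by simpa using h₁) (Runs.push rev none _))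
      simp only [Reg.update_rev, Reg.mk_rev] at h₂
      refine (Runs.loop_cons ?_ (Reg.update_mat ..) h₂ (ih (fun i => A i.succ) _ _)).congr ?_ ?_
      · simp [encodeRows_succ, List.ofFn_succ]
      · simp [encodeRows_succ, List.ofFn_succ]
      · linarith
  refine (Runs.seq (key m A o []) (runs_move (by decide) _)).congr (by simp) ?_
  simp [length_encodeRows]; linarith

/-- Write the rows of the adjacency matrix for the row vertices, and store the matrix. -/
def rowVertices : StackProg Reg (Option Bool) :=
  seq (emit rows tmp aux (some true))
    (seq (loop aux Option.isNone fun _ => seq (emit rows tmp out (some false))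
        (seq (copyRow inp out rev) (seq (push rev none)
          (pushList out [some true, some false, some false, none]))))
      (move rev mat))

theorem runs_rowVertices {m n : ℕ} (A : Fin m → Fin n → Bool) (i o a b : List (Option Bool))
    (ha : a.length = m) :
    Runs rowVertices (Reg.mk (encodeRows A ++ i) o a b [] [] [] [])
      (Reg.mk i ((List.ofFn fun i => List.replicate m (some false) ++ (List.ofFn (A i)).map some ++
        [some true, some false, some false, none]).flatten.reverse ++ o) a b [] []
        (encodeRows A) []) (m * (10 * m + 5 * n + 30) + 4) := by
  -- Here `k` counts the rows left, while the padding of `m` zeros is governed by the fixed counter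
  -- `a`.
  have key : ∀ (k : ℕ) (A : Fin k → Fin n → Bool) (o r u : List (Option Bool)), u.length = k →
      Runs (loop aux Option.isNone fun _ => seq (emit rows tmp out (some false))
        (seq (copyRow inp out rev) (seq (push rev none)
          (pushList out [some true, some false, some false, none]))))
        (Reg.mk (encodeRows A ++ i) o a b [] u [] r)
        (Reg.mk i ((List.ofFn fun i => List.replicate m (some false) ++
          (List.ofFn (A i)).map some ++
          [some true, some false, some false, none]).flatten.reverse ++ o) a b [] [] []
          ((encodeRows A).reverse ++ r)) (k * (5 * m + 3 * n + 10) + 1) := by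
    intro k
    induction k with
    | zero =>
      intro A o r u hu
      exact (Runs.loop_nil (by simpa using hu)).congr (by simp_all [encodeRows]) (by simp)
    | succ k ih =>
      intro A o r u hu
      obtain ⟨x, u, rfl⟩ := List.exists_cons_of_length_eq_add_one hu
      have h₁ := runs_emit (c := rows) (t := tmp) (d := out) (by decide) (by decide) (by decide)
        (some false) (Reg.mk (encodeRows A ++ i) o a b [] u [] r) rfl
      simp only [Reg.update_out, Reg.mk_out, Reg.mk_rows, ha] at h₁
      have h₂ := runs_copyRow (k := inp) (d := out) (e := rev) (by decide) (by decide) (by decide)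
        (List.ofFn (A 0)) (encodeRows (fun i => A i.succ) ++ i)
        (Reg.mk (encodeRows A ++ i) (List.replicate m (some false) ++ o) a b [] u [] r)
        (by simp [encodeRows_succ])
      simp only [Reg.update_out, Reg.mk_out, Reg.update_inp, Reg.update_rev, Reg.mk_rev] at h₂
      have h₃ := h₁.seq (h₂.seq ((Runs.push rev none _).seq
        (runs_pushList out [some true, some false, some false, none] _)))
      simp only [Reg.update_out, Reg.mk_out, Reg.update_rev, Reg.mk_rev] at h₃
      refine (Runs.loop_cons (Reg.mk_aux ..) (Reg.update_aux ..) h₃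
        (ih (fun i => A i.succ) _ _ u (by simpa using hu))).congr ?_ ?_
      · simp [encodeRows_succ, List.ofFn_succ]
      · simp; linarith
  have h₁ := runs_emit (c := rows) (t := tmp) (d := aux) (by decide) (by decide) (by decide)
        (some true) (Reg.mk (encodeRows A ++ i) o a b [] [] [] []) rfl
  simp only [Reg.update_aux, Reg.mk_aux, Reg.mk_rows, ha] at h₁
  refine (h₁.seq ((key m A o [] _ (by simp)).seq (runs_move (by decide) _))).congr (by simp) ?_
  simp [length_encodeRows]
  nlinarith

/-- Write the rows of the adjacency matrix for the column vertices, and forget the matrix. -/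
def colVertices : StackProg Reg (Option Bool) :=
  seq (emit cols tmp aux (some true))
    (seq (loop aux Option.isNone fun _ => seq peel (seq (emit cols tmp out (some false))
          (pushList out [some false, some false, some false, none])))
      (clear mat))

/-- Column vertices need the transpose, obtained by peeling off first columns. This takes a pass
over the matrix per column and is the source of the cubic time bound. -/
theorem runs_colVertices {m n : ℕ} (A : Fin m → Fin n → Bool) (i o a b : List (Option Bool))
    (hb : b.length = n) :
    Runs colVertices (Reg.mk i o a b [] [] (encodeRows A) [])
      (Reg.mk i ((List.ofFn fun j => (List.ofFn fun i => some (A i j)) ++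
        List.replicate n (some false) ++
        [some false, some false, some false, none]).flatten.reverse ++ o) a b [] [] [] [])
        (n * (m * (4 * n + 10) + 5 * n + 20) + 2 * m + 10) := by
  -- `k` is the number of columns left; `k ≤ n` bounds the cost of peeling the narrower matrix. At
  -- the end only the `m` separators remain on `mat`.
  have key : ∀ (k : ℕ) (A : Fin m → Fin k → Bool) (o u : List (Option Bool)), k ≤ n →
      u.length = k →
      Runs (loop aux Option.isNone fun _ => seq peel (seq (emit cols tmp out (some false))
          (pushList out [some false, some false, some false, none])))
        (Reg.mk i o a b [] u (encodeRows A) [])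
        (Reg.mk i ((List.ofFn fun j => (List.ofFn fun i => some (A i j)) ++
          List.replicate n (some false) ++
          [some false, some false, some false, none]).flatten.reverse ++ o) a b [] []
          (List.replicate m none) []) (k * (m * (4 * n + 10) + 5 * n + 10) + 1) := by
    intro k
    induction k with
    | zero =>
      intro A o u _ hu
      refine (Runs.loop_nil (by simpa using hu)).congr ?_ (by simp)
      obtain rfl : u = [] := by simpa using hu
      simp [encodeRows, Cube2.encodeRow, List.ofFn_const]
    | succ k ih =>
      intro A o u hk hu
      obtain ⟨x, u, rfl⟩ := List.exists_cons_of_length_eq_add_one hu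
      have h₁ := runs_peel A i o a b u
      have h₂ := runs_emit (c := cols) (t := tmp) (d := out) (by decide) (by decide) (by decide)
        (some false) (Reg.mk i ((List.ofFn fun i => some (A i 0)).reverse ++ o) a b [] u
        (encodeRows fun i j => A i j.succ) []) rfl
      simp only [Reg.update_out, Reg.mk_out, Reg.mk_cols, hb] at h₂
      have h₃ := h₁.seq (h₂.seq
        (runs_pushList out [some false, some false, some false, none] _))
      simp only [Reg.update_out, Reg.mk_out] at h₃
      refine (Runs.loop_cons (Reg.mk_aux ..) (Reg.update_aux ..) h₃
        (ih (fun i j => A i j.succ) _ u (by omega) (by simpa using hu))).congr ?_ ?_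
      · simp [List.ofFn_succ]
      · have : m * (4 * k + 10) ≤ m * (4 * n + 10) := by gcongr; omega
        simp; linarith
  have h₁ := runs_emit (c := cols) (t := tmp) (d := aux) (by decide) (by decide) (by decide)
        (some true) (Reg.mk i o a b [] [] (encodeRows A) []) rfl
  simp only [Reg.update_aux, Reg.mk_aux, Reg.mk_cols, hb] at h₁
  refine (h₁.seq ((key n A o _ le_rfl (by simp)).seq (runs_clear _ _))).congr (by simp) ?_
  simp
  nlinarith

/-! ### Block matrices -/

/-- The first block, the second block and the special indices of a block matrix. -/
def blockEquiv (m n k : ℕ) : Fin (m + n + k) ≃ (Fin m ⊕ Fin n) ⊕ Fin k :=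
  ((Equiv.sumCongr finSumFinEquiv (Equiv.refl _)).trans finSumFinEquiv).symm

theorem ofFn_blockEquiv {α : Type*} {m n k : ℕ} (F : (Fin m ⊕ Fin n) ⊕ Fin k → α) :
    (List.ofFn fun i => F (blockEquiv m n k i)) =
      (List.ofFn fun i => F (.inl (.inl i))) ++ ((List.ofFn fun i => F (.inl (.inr i))) ++
        List.ofFn fun i => F (.inr i)) := by
  have h : ∀ {a b : ℕ} (G : Fin a ⊕ Fin b → α),
      (List.ofFn fun i => G (finSumFinEquiv.symm i)) =
        (List.ofFn fun i => G (.inl i)) ++ List.ofFn fun i => G (.inr i) := by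
    intro a b G
    rw [List.ofFn_add]
    congr 2 <;> funext i
    · exact congrArg G (finSumFinEquiv_symm_apply_castAdd i)
    · exact congrArg G (finSumFinEquiv_symm_apply_natAdd i)
  -- `h₁` splits off the special indices, `h₂` separates the two blocks.
  have h₁ := h fun x => F (Sum.map finSumFinEquiv.symm id x)
  have h₂ := h fun x => F (.inl x)
  simp only [Sum.map_inl, Sum.map_inr, id] at h₁
  rw [h₂, List.append_assoc] at h₁
  exact h₁

/-- Relabel the rows and columns of a block matrix by natural numbers. -/
def blockCube {m n k : ℕ} (W : (Fin m ⊕ Fin n) ⊕ Fin k → (Fin m ⊕ Fin n) ⊕ Fin k → Bool) :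
    Cube2 where
  rows := m + n + k
  cols := m + n + k
  entry := fun i j => W (blockEquiv m n k i) (blockEquiv m n k j)

/-- The code of a row of a block matrix. -/
def encodeBlockRow {m n k : ℕ} (r : (Fin m ⊕ Fin n) ⊕ Fin k → Bool) : List (Option Bool) :=
  (List.ofFn fun i => some (r (.inl (.inl i)))) ++ ((List.ofFn fun i => some (r (.inl (.inr i)))) ++
    ((List.ofFn fun i => some (r (.inr i))) ++ [none]))

/-- Cuts the code into the segments that the programs write, so that correctness becomes an equality
of words. -/
theorem encode_blockCube {m n k : ℕ}
    (W : (Fin m ⊕ Fin n) ⊕ Fin k → (Fin m ⊕ Fin n) ⊕ Fin k → Bool) :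
    (blockCube W).encode =
      List.replicate (m + n + k) (some true) ++ none ::
        (List.replicate (m + n + k) (some true) ++ none ::
          ((List.ofFn fun i => encodeBlockRow (W (.inl (.inl i)))).flatten ++
          ((List.ofFn fun i => encodeBlockRow (W (.inl (.inr i)))).flatten ++
          (List.ofFn fun i => encodeBlockRow (W (.inr i))).flatten))) := by
  have h : ∀ r : (Fin m ⊕ Fin n) ⊕ Fin k → Bool,
      Cube2.encodeRow (fun i => r (blockEquiv m n k i)) = encodeBlockRow r := by
    intro r
    simp [Cube2.encodeRow, encodeBlockRow, ofFn_blockEquiv, Function.comp_def]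
  simp only [Cube2.encode, blockCube, h]
  rw [ofFn_blockEquiv fun x => encodeBlockRow (W x)]
  simp

/-! ### The graph of a matrix -/

/-- The adjacency of the graph of a matrix: rows and columns are vertices, and there are three
additional vertices forming a triangle, one of which is adjacent to all rows. -/
def matrixAdj {α β : Type*} (A : α → β → Bool) : (α ⊕ β) ⊕ Fin 3 → (α ⊕ β) ⊕ Fin 3 → Bool
  | .inl (.inl i), .inl (.inr j) => A i j
  | .inl (.inr j), .inl (.inl i) => A i j
  | .inl (.inl _), .inr k => k = 0
  | .inr k, .inl (.inl _) => k = 0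
  | .inr k, .inr l => k ≠ l
  | _, _ => false

/-- Write the adjacency matrix of the graph of a matrix. -/
def writeGraph : StackProg Reg (Option Bool) :=
  let dim := seq (emit rows tmp out (some true)) (seq (emit cols tmp out (some true))
    (pushList out [some true, some true, some true, none]))
  seq readDims (seq dim (seq dim (seq rowVertices (seq colVertices
    (seq (emit rows tmp out (some true)) (seq (emit cols tmp out (some false))
      (seq (pushList out [some false, some true, some true, none])
    (seq (emit rows tmp out (some false)) (seq (emit cols tmp out (some false))
      (seq (pushList out [some true, some false, some true, none])
    (seq (emit rows tmp out (some false)) (seq (emit cols tmp out (some false))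
      (seq (pushList out [some true, some true, some false, none])
    (seq (clear rows) (clear cols)))))))))))))))

theorem runs_emit_rows (x : Option Bool) (i o a b u s r : List (Option Bool)) :
    Runs (emit rows tmp out x) (Reg.mk i o a b [] u s r)
      (Reg.mk i (List.replicate a.length x ++ o) a b [] u s r) (5 * a.length + 2) := by
  exact (runs_emit (c := rows) (t := tmp) (d := out) (by decide) (by decide) (by decide)
    x (Reg.mk i o a b [] u s r) rfl).congr
    (Reg.update_out ..) le_rfl

theorem runs_emit_cols (x : Option Bool) (i o a b u s r : List (Option Bool)) :
    Runs (emit cols tmp out x) (Reg.mk i o a b [] u s r)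
      (Reg.mk i (List.replicate b.length x ++ o) a b [] u s r) (5 * b.length + 2) := by
  exact (runs_emit (c := cols) (t := tmp) (d := out) (by decide) (by decide) (by decide)
    x (Reg.mk i o a b [] u s r) rfl).congr
    (Reg.update_out ..) le_rfl

theorem runs_pushList_out (l i o a b t u s r : List (Option Bool)) :
    Runs (pushList out l) (Reg.mk i o a b t u s r)
      (Reg.mk i (l.reverse ++ o) a b t u s r) (l.length + 1) := 
  (runs_pushList out l (Reg.mk i o a b t u s r)).congr (Reg.update_out ..) le_rfl

theorem runs_clear_rows (i o a b t u s r : List (Option Bool)) :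
    Runs (clear rows) (Reg.mk i o a b t u s r) (Reg.mk i o [] b t u s r) (2 * a.length + 1) := 
  (runs_clear rows (Reg.mk i o a b t u s r)).congr (Reg.update_rows ..) le_rfl

theorem runs_clear_cols (i o a b t u s r : List (Option Bool)) :
    Runs (clear cols) (Reg.mk i o a b t u s r) (Reg.mk i o a [] t u s r) (2 * b.length + 1) := 
  (runs_clear cols (Reg.mk i o a b t u s r)).congr (Reg.update_cols ..) le_rfl

theorem runs_writeGraph (C : Cube2) (i o : List (Option Bool)) :
    Runs writeGraph (Reg.mk (C.encode ++ i) o [] [] [] [] [] [])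
      (Reg.mk i ((blockCube (matrixAdj C.entry)).encode.reverse ++ o) [] [] [] [] [] [])
      (C.rows * (10 * C.rows + 5 * C.cols + 30) +
        C.cols * (C.rows * (4 * C.cols + 10) + 5 * C.cols + 20) +
        40 * C.rows + 40 * C.cols + 200) := by
  obtain ⟨m, n, A⟩ := C
  have hdims : (Cube2.mk m n A).encode ++ i = List.replicate m (some true) ++ none ::
      (List.replicate n (some true) ++ none :: (encodeRows A ++ i)) := by
    simp [Cube2.encode, encodeRows]
  rw [hdims]
  have dim := fun (o : List (Option Bool)) => Runs.seq
    (runs_emit_rows (some true) (encodeRows A ++ i) o (List.replicate m (some true))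
      (List.replicate n (some true)) [] [] []) (Runs.seq (runs_emit_cols (some true) ..)
    (runs_pushList_out [some true, some true, some true, none] ..))
  refine (Runs.seq (runs_readDims m n (encodeRows A ++ i) o) (Runs.seq (dim _) (Runs.seq (dim _)
    (Runs.seq (runs_rowVertices A i _ _ _ (by simp)) (Runs.seq
    (runs_colVertices A i _ _ _ (by simp))
    (Runs.seq (runs_emit_rows ..) (Runs.seq (runs_emit_cols ..) (Runs.seq (runs_pushList_out ..)
    (Runs.seq (runs_emit_rows ..) (Runs.seq (runs_emit_cols ..) (Runs.seq (runs_pushList_out ..)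
    (Runs.seq (runs_emit_rows ..) (Runs.seq (runs_emit_cols ..) (Runs.seq (runs_pushList_out ..)
    (Runs.seq (runs_clear_rows ..) (runs_clear_cols ..)))))))))))))))).congr ?_ ?_
  · rw [encode_blockCube]
    -- The unary dimension is split the way `dim` writes it; the simp lemma that would merge the
    -- pieces again is disabled below.
    have h : List.replicate (m + n + 3) (some true) = List.replicate m (some true) ++
        (List.replicate n (some true) ++ [some true, some true, some true]) := by
      simp only [List.replicate_add, List.append_assoc]
      rfl
    simp [encodeBlockRow, matrixAdj, Function.comp_def, h,
      -List.replicate_append_replicate]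
  · simp only [List.length_replicate, List.length_cons, List.length_nil]
    linarith

/-! ### The square matrix of a graph -/

/-- The square matrix of a graph: the first block of rows is the adjacency matrix followed by an
identity matrix, the second block consists of two identity matrices, and two pairs of equal rows
and of equal columns tell the blocks apart. -/
def linkedMatrix {α : Type*} [DecidableEq α] (A : α → α → Bool) :
    (α ⊕ α) ⊕ Fin 2 → (α ⊕ α) ⊕ Fin 2 → Bool
  | .inl (.inl i), .inl (.inl j) => A i j
  | .inl (.inl i), .inl (.inr j) => i = j
  | .inl (.inr i), .inl (.inl j) => i = j
  | .inl (.inr i), .inl (.inr j) => i = j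
  | .inl (.inl _), .inr _ => true
  | .inr _, .inl (.inl _) => true
  | _, _ => false

/-- A row of an identity matrix. -/
def unitRow (c k : ℕ) : List (Option Bool) :=
  List.replicate c (some false) ++ some true :: List.replicate k (some false)

theorem ofFn_eq_unitRow {n : ℕ} (i : Fin n) :
    (List.ofFn fun j => some (decide (i = j))) = unitRow i (n - 1 - i) := by
  refine List.ext_getElem (by simp [unitRow]; omega) fun j h₁ h₂ => ?_
  simp only [List.length_ofFn] at h₁
  simp only [List.getElem_ofFn, unitRow, List.getElem_append, List.getElem_cons,
    List.length_replicate, List.getElem_replicate, Fin.ext_iff]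
  split_ifs <;> simp <;> omega

/-- Write a row of an identity matrix, with the position of its one on two stacks. -/
def writeUnitRow : StackProg Reg (Option Bool) :=
  seq (emit mat tmp out (some false)) (seq (push out (some true)) (emit aux tmp out (some false)))

theorem runs_writeUnitRow (i o a b u s r : List (Option Bool)) :
    Runs writeUnitRow (Reg.mk i o a b [] u s r)
      (Reg.mk i ((unitRow s.length u.length).reverse ++ o) a b [] u s r)
      (5 * s.length + 5 * u.length + 5) := by
  have h₁ := (runs_emit (c := mat) (t := tmp) (d := out) (by decide) (by decide) (by decide)
    (some false) (Reg.mk i o a b [] u s r) rfl).congr (Reg.update_out ..) le_rfl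
  have h₂ := fun o => (runs_emit (c := aux) (t := tmp) (d := out) (by decide) (by decide)
    (by decide) (some false) (Reg.mk i o a b [] u s r) rfl).congr (Reg.update_out ..) le_rfl
  refine (h₁.seq (((Runs.push out (some true) _).congr (Reg.update_out ..) le_rfl).seq
    (h₂ _))).congr (by simp [unitRow]) ?_
  simp; omega

/-- Write the first block of rows of the square matrix of a graph. -/
def writeLinkedRows : StackProg Reg (Option Bool) :=
  loop aux Option.isNone fun _ => seq (moveRow inp out) (seq writeUnitRow
    (seq (pushList out [some true, some true, none]) (push mat (some true))))

/-- `mat` counts the rows already written, and `aux`, popped at the loop head, those after the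
current one. These are the numbers of zeros before and after the diagonal one, so no arithmetic is
needed on the machine. -/
theorem runs_writeLinkedRows {k n c N : ℕ} (hN : c + k = N) (A : Fin k → Fin n → Bool)
    (i o a b u r : List (Option Bool)) (hu : u.length = k) :
    Runs writeLinkedRows (Reg.mk (encodeRows A ++ i) o a b [] u (List.replicate c (some true)) r)
      (Reg.mk i ((List.ofFn fun i : Fin k => (List.ofFn (A i)).map some ++
        (unitRow (c + i) (k - 1 - i) ++ [some true, some true, none])).flatten.reverse ++ o)
        a b [] [] (List.replicate N (some true)) r) (k * (2 * n + 5 * N + 20) + 1) := by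
  induction k generalizing o u c with
  | zero =>
    obtain rfl : u = [] := by simpa using hu
    obtain rfl : c = N := hN
    exact (Runs.loop_nil rfl).congr (by simp [encodeRows]) (by simp)
  | succ k ih =>
    obtain ⟨x, u, rfl⟩ := List.exists_cons_of_length_eq_add_one hu
    simp only [List.length_cons, Nat.add_right_cancel_iff] at hu
    have h₁ := ((runs_moveRow (k := inp) (d := out) (by decide) (List.ofFn (A 0))
      (encodeRows (fun i => A i.succ) ++ i)
      (Reg.mk (encodeRows A ++ i) o a b [] u (List.replicate c (some true)) r)
      (by simp [encodeRows_succ])).congr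
        ((congrArg (Function.update · out _) (Reg.update_inp ..)).trans (Reg.update_out ..))
        le_rfl).seq ((runs_writeUnitRow ..).seq
      ((runs_pushList_out [some true, some true, none] ..).seq
      ((Runs.push mat (some true) _).congr (Reg.update_mat ..) le_rfl)))
    refine (Runs.loop_cons (Reg.mk_aux ..) (Reg.update_aux ..) h₁
      (ih (c := c + 1) (by omega) (fun i => A i.succ) _ u hu)).congr ?_ ?_
    · have e₁ : ∀ i : Fin k, c + 1 + (i : ℕ) = c + (i + 1) := fun i => by ring
      have e₂ : ∀ i : Fin k, k - 1 - (i : ℕ) = k - (i + 1) := fun i => by omega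
      simp [List.ofFn_succ, hu, e₁, e₂]
    · simp [hu]; linarith

/-- Write the second block of rows of the square matrix of a graph. -/
def writeUnitRows : StackProg Reg (Option Bool) :=
  loop aux Option.isNone fun _ => seq writeUnitRow (seq writeUnitRow
    (seq (pushList out [some false, some false, none]) (push mat (some true))))

theorem runs_writeUnitRows {k c N : ℕ} (hN : c + k = N)
    (i o a b u r : List (Option Bool)) (hu : u.length = k) :
    Runs writeUnitRows (Reg.mk i o a b [] u (List.replicate c (some true)) r)
      (Reg.mk i ((List.ofFn fun i : Fin k => unitRow (c + i) (k - 1 - i) ++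
        (unitRow (c + i) (k - 1 - i) ++ [some false, some false, none])).flatten.reverse ++ o)
        a b [] [] (List.replicate N (some true)) r) (k * (10 * N + 20) + 1) := by
  induction k generalizing o u c with
  | zero =>
    obtain rfl : u = [] := by simpa using hu
    obtain rfl : c = N := hN
    exact (Runs.loop_nil rfl).congr (by simp) (by simp)
  | succ k ih =>
    obtain ⟨x, u, rfl⟩ := List.exists_cons_of_length_eq_add_one hu
    simp only [List.length_cons, Nat.add_right_cancel_iff] at hu
    have h₁ := (runs_writeUnitRow i o a b u (List.replicate c (some true)) r).seq
      ((runs_writeUnitRow ..).seq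
      ((runs_pushList_out [some false, some false, none] ..).seq
      ((Runs.push mat (some true) _).congr (Reg.update_mat ..) le_rfl)))
    refine (Runs.loop_cons (Reg.mk_aux ..) (Reg.update_aux ..) h₁
      (ih (c := c + 1) (by omega) _ u hu)).congr ?_ ?_
    · have e₁ : ∀ i : Fin k, c + 1 + (i : ℕ) = c + (i + 1) := fun i => by ring
      have e₂ : ∀ i : Fin k, k - 1 - (i : ℕ) = k - (i + 1) := fun i => by omega
      simp [List.ofFn_succ, hu, e₁, e₂]
    · simp [hu]; linarith

/-- Write the square matrix of a graph. -/
def writeLinkedMatrix : StackProg Reg (Option Bool) :=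
  let dim := seq (emit rows tmp out (some true)) (seq (emit cols tmp out (some true))
    (pushList out [some true, some true, none]))
  let last := seq (emit rows tmp out (some true)) (seq (emit cols tmp out (some false))
    (pushList out [some false, some false, none]))
  seq readDims (seq dim (seq dim (seq (emit rows tmp aux (some true)) (seq writeLinkedRows
    (seq (clear mat) (seq (emit rows tmp aux (some true)) (seq writeUnitRows (seq (clear mat)
    (seq last (seq last (seq (clear rows) (clear cols))))))))))))

theorem runs_writeLinkedMatrix {n : ℕ} (A : Fin n → Fin n → Bool) (i o : List (Option Bool)) :
    Runs writeLinkedMatrix (Reg.mk ((Cube2.mk n n A).encode ++ i) o [] [] [] [] [] [])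
      (Reg.mk i ((blockCube (linkedMatrix A)).encode.reverse ++ o) [] [] [] [] [] [])
      (n * (17 * n + 150) + 200) := by
  have hdims : (Cube2.mk n n A).encode ++ i = List.replicate n (some true) ++ none ::
      (List.replicate n (some true) ++ none :: (encodeRows A ++ i)) := by
    simp [Cube2.encode, encodeRows]
  rw [hdims]
  have block := fun (x y : Option Bool) l (i o : List (Option Bool)) => Runs.seq
    (runs_emit_rows x i o (List.replicate n (some true))
      (List.replicate n (some true)) [] [] []) (Runs.seq (runs_emit_cols y ..)
    (runs_pushList_out l ..))
  have count := fun i o => ((runs_emit (c := rows) (t := tmp) (d := aux) (by decide) (by decide)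
    (by decide) (some true) (Reg.mk i o (List.replicate n (some true))
    (List.replicate n (some true)) [] [] [] []) rfl).congr (Reg.update_aux ..) le_rfl)
  -- Each of the two loops leaves `n` marks on `mat`, which must be gone before the next use.
  have clr := fun i o => (runs_clear mat (Reg.mk i o (List.replicate n (some true))
    (List.replicate n (some true)) [] [] (List.replicate n (some true)) [])).congr
    (Reg.update_mat ..) le_rfl
  refine (Runs.seq (runs_readDims n n (encodeRows A ++ i) o) (Runs.seq (block ..)
    (Runs.seq (block ..) (Runs.seq (count ..)
    (Runs.seq (runs_writeLinkedRows (c := 0) (zero_add n) A _ _ _ _ _ _ (by simp))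
    (Runs.seq (clr ..) (Runs.seq (count ..)
    (Runs.seq (runs_writeUnitRows (c := 0) (zero_add n) _ _ _ _ _ _ (by simp))
    (Runs.seq (clr ..) (Runs.seq (block ..) (Runs.seq (block ..)
    (Runs.seq (runs_clear_rows ..) (runs_clear_cols ..))))))))))))).congr ?_ ?_
  · rw [encode_blockCube]
    have h : List.replicate (n + n + 2) (some true) = List.replicate n (some true) ++
        (List.replicate n (some true) ++ [some true, some true]) := by
      simp only [List.replicate_add, List.append_assoc]
      rfl
    simp [encodeBlockRow, linkedMatrix, Function.comp_def, h,
      -List.replicate_append_replicate, ofFn_eq_unitRow]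
  · simp
    nlinarith

/-- Turns the invariance of a block into a bijection of its indices: the hypothesis holds whenever
the block is singled out by a property that `e` preserves. -/
theorem exists_equiv_of_range {X Y α β : Type*} (e : X ≃ Y) {ι : α → X} {κ : β → Y}
    (hι : Function.Injective ι) (hκ : Function.Injective κ)
    (h : ∀ x, (∃ a, x = ι a) ↔ ∃ b, e x = κ b) : ∃ γ : α ≃ β, ∀ a, e (ι a) = κ (γ a) := by
  choose f hf using fun a => (h (ι a)).1 ⟨a, rfl⟩
  have hinj : Function.Injective f := fun a a' haa => hι (e.injective (by rw [hf, hf, haa]))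
  have hsurj : Function.Surjective f := by
    intro b
    obtain ⟨a, ha⟩ := (h (e.symm (κ b))).2 ⟨b, by simp⟩
    exact ⟨a, hκ (by rw [← hf, ← ha, e.apply_symm_apply])⟩
  exact ⟨Equiv.ofBijective f ⟨hinj, hsurj⟩, hf⟩

/-! ### Matrices up to similarity and their graphs -/

/-- The graph of a matrix. -/
def matrixGraph {α β : Type*} (A : α → β → Bool) : SimpleGraph ((α ⊕ β) ⊕ Fin 3) where
  Adj x y := matrixAdj A x y = true
  symm := ⟨by
    rintro ((i | i) | i) ((j | j) | j) <;>
      first | exact id | (simp only [matrixAdj, decide_eq_true_eq]; exact Ne.symm)⟩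
  loopless := ⟨by rintro ((i | i) | i) <;> simp [matrixAdj]⟩

namespace SimpleGraph

variable {V W : Type*}

/-- A vertex lies in a triangle. -/
def InTriangle (G : SimpleGraph V) (x : V) : Prop :=
  ∃ y z, G.Adj x y ∧ G.Adj y z ∧ G.Adj x z

theorem inTriangle_iso {G : SimpleGraph V} {H : SimpleGraph W} (φ : G ≃g H) (x : V) :
    H.InTriangle (φ x) ↔ G.InTriangle x := by
  simp [InTriangle, φ.surjective.exists, φ.map_adj_iff]

theorem exists_adj_inTriangle_iso {G : SimpleGraph V} {H : SimpleGraph W} (φ : G ≃g H) (x : V) :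
    (∃ y, H.Adj (φ x) y ∧ H.InTriangle y) ↔ ∃ y, G.Adj x y ∧ G.InTriangle y := by
  simp [φ.surjective.exists, φ.map_adj_iff, inTriangle_iso]

end SimpleGraph

section

variable {α β α' β' : Type*}

/-- Rows are pairwise non-adjacent, and so are columns. The only other neighbour of a row is the
special vertex `0`, which is adjacent to no column, so no triangle contains a row or a column. -/
theorem inTriangle_matrixGraph (A : α → β → Bool) (x : (α ⊕ β) ⊕ Fin 3) :
    (matrixGraph A).InTriangle x ↔ ∃ k, x = .inr k := by
  constructor
  · rintro ⟨y, z, h₁, h₂, h₃⟩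
    rcases x with (i | i) | i <;> rcases y with (j | j) | j <;> rcases z with (k | k) | k <;>
      simp_all [matrixGraph, matrixAdj]
  · rintro ⟨k, rfl⟩
    refine ⟨.inr (k + 1), .inr (k + 2), ?_⟩
    fin_cases k <;> simp [matrixGraph, matrixAdj]

/-- The extra edges to vertex `0` mark the rows whatever the entries are, even for a zero matrix or
one without columns. -/
theorem isRow_matrixGraph (A : α → β → Bool) (x : (α ⊕ β) ⊕ Fin 3) :
    (¬ (matrixGraph A).InTriangle x ∧ ∃ y, (matrixGraph A).Adj x y ∧ (matrixGraph A).InTriangle y) ↔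
      ∃ i, x = .inl (.inl i) := by
  simp only [inTriangle_matrixGraph]
  rcases x with (i | i) | i <;> simp [matrixGraph, matrixAdj]

theorem isCol_matrixGraph (A : α → β → Bool) (x : (α ⊕ β) ⊕ Fin 3) :
    (¬ (matrixGraph A).InTriangle x ∧
      ¬ ∃ y, (matrixGraph A).Adj x y ∧ (matrixGraph A).InTriangle y) ↔
      ∃ j, x = .inl (.inr j) := by
  simp only [inTriangle_matrixGraph]
  rcases x with (i | i) | i <;> simp [matrixGraph, matrixAdj]

theorem exists_submatrix_iff_nonempty_iso (A : α → β → Bool) (B : α' → β' → Bool) :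
    (∃ (γ₁ : α' ≃ α) (γ₂ : β' ≃ β), ∀ i j, A (γ₁ i) (γ₂ j) = B i j) ↔
      Nonempty (matrixGraph A ≃g matrixGraph B) := by
  constructor
  · rintro ⟨γ₁, γ₂, h⟩
    -- The bijections lead from the indices of `B` to those of `A`, hence the inverse here and in
    -- the converse.
    refine ⟨RelIso.symm ⟨Equiv.sumCongr (Equiv.sumCongr γ₁ γ₂) (Equiv.refl _), ?_⟩⟩
    rintro ((i | i) | i) ((j | j) | j) <;> simp [matrixGraph, matrixAdj, h]
  · rintro ⟨ψ⟩
    let φ := ψ.symm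
    obtain ⟨γ₁, h₁⟩ := exists_equiv_of_range φ.toEquiv (ι := fun i : α' => .inl (.inl i))
      (κ := fun i : α => .inl (.inl i)) (fun _ _ h => by simpa using h)
      (fun _ _ h => by simpa using h) fun x => by
        rw [← isRow_matrixGraph B, ← isRow_matrixGraph A]
        exact and_congr (not_congr (SimpleGraph.inTriangle_iso φ x).symm)
          (SimpleGraph.exists_adj_inTriangle_iso φ x).symm
    obtain ⟨γ₂, h₂⟩ := exists_equiv_of_range φ.toEquiv (ι := fun i : β' => .inl (.inr i))
      (κ := fun i : β => .inl (.inr i)) (fun _ _ h => by simpa using h)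
      (fun _ _ h => by simpa using h) fun x => by
        rw [← isCol_matrixGraph B, ← isCol_matrixGraph A]
        exact and_congr (not_congr (SimpleGraph.inTriangle_iso φ x).symm)
          (not_congr (SimpleGraph.exists_adj_inTriangle_iso φ x).symm)
    refine ⟨γ₁, γ₂, fun i j => ?_⟩
    -- Adjacency of a row vertex and a column vertex is the matrix entry itself.
    have h := φ.map_rel_iff (a := .inl (.inl i)) (b := .inl (.inr j))
    rw [show φ (.inl (.inl i)) = _ from h₁ i, show φ (.inl (.inr j)) = _ from h₂ j] at h
    exact Bool.eq_iff_iff.2 h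

end

/-- The graph of a matrix, with its vertices numbered. -/
def cubeGraph (C : Cube2) : FiniteGraph where
  order := C.rows + C.cols + 3
  graph := (matrixGraph C.entry).comap (blockEquiv C.rows C.cols 3)

theorem adjacency_cubeGraph (C : Cube2) :
    (cubeGraph C).adjacency = blockCube (matrixAdj C.entry) := by
  simp only [FiniteGraph.adjacency, cubeGraph, blockCube]
  congr 1
  funext i j
  simp [matrixGraph]
  rfl

theorem similar_iff_nonempty_iso (C D : Cube2) :
    C.Similar D ↔ Nonempty ((cubeGraph C).graph ≃g (cubeGraph D).graph) := by
  have hC := SimpleGraph.Iso.comap (blockEquiv C.rows C.cols 3) (matrixGraph C.entry)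
  have hD := SimpleGraph.Iso.comap (blockEquiv D.rows D.cols 3) (matrixGraph D.entry)
  have h : Nonempty ((cubeGraph C).graph ≃g (cubeGraph D).graph) ↔
      Nonempty (matrixGraph C.entry ≃g matrixGraph D.entry) :=
    ⟨fun ⟨φ⟩ => ⟨(hC.symm.trans φ).trans hD⟩, fun ⟨φ⟩ => ⟨(hC.trans φ).trans hD.symm⟩⟩
  refine Iff.trans ?_ ((exists_submatrix_iff_nonempty_iso C.entry D.entry).trans h.symm)
  exact exists_congr fun γ₁ => exists_congr fun γ₂ =>
    ⟨fun h i j => congrFun (congrFun h i) j, fun h => funext fun i => funext fun j => h i j⟩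

/-! ### Graphs and their square matrices -/

section

variable {X Y X' Y' α α' : Type*}

/-- A row that occurs at least twice in a matrix. -/
def IsTwinRow (W : X → Y → Bool) (x : X) : Prop :=
  ∃ x', x' ≠ x ∧ ∀ y, W x' y = W x y

/-- A row with a one in a column that occurs at least twice. -/
def IsMarkedRow (W : X → Y → Bool) (x : X) : Prop :=
  ∃ y, IsTwinRow (fun y x => W x y) y ∧ W x y = true

theorem isTwinRow_iff_of_equiv {W : X → Y → Bool} {W' : X' → Y' → Bool} (γ₁ : X' ≃ X)
    (γ₂ : Y' ≃ Y) (h : ∀ x y, W (γ₁ x) (γ₂ y) = W' x y) (x : X') :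
    IsTwinRow W (γ₁ x) ↔ IsTwinRow W' x := by
  simp [IsTwinRow, γ₁.surjective.exists, γ₂.surjective.forall, h]

theorem isMarkedRow_iff_of_equiv {W : X → Y → Bool} {W' : X' → Y' → Bool} (γ₁ : X' ≃ X)
    (γ₂ : Y' ≃ Y) (h : ∀ x y, W (γ₁ x) (γ₂ y) = W' x y) (x : X') :
    IsMarkedRow W (γ₁ x) ↔ IsMarkedRow W' x := by
  have := isTwinRow_iff_of_equiv (W := fun y x => W x y) (W' := fun y x => W' x y) γ₂ γ₁
    fun y x => h x y
  simp [IsMarkedRow, γ₂.surjective.exists, h, this]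

variable [DecidableEq α] [DecidableEq α']

/-- Carries every statement about rows over to columns. Since `A` is transposed as well, no symmetry
of `A` is needed. -/
theorem linkedMatrix_transpose (A : α → α → Bool) (x y : (α ⊕ α) ⊕ Fin 2) :
    linkedMatrix A x y = linkedMatrix (fun i j => A j i) y x := by
  rcases x with (i | i) | i <;> rcases y with (j | j) | j <;> simp [linkedMatrix, eq_comm]

/-- The special columns separate the first block from all other rows; the identity blocks separate
the rows within each of the first two blocks, and the second block from the special rows. Equal rows
of `A` thus do no harm. -/
theorem isTwinRow_linkedMatrix (A : α → α → Bool) (x : (α ⊕ α) ⊕ Fin 2) :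
    IsTwinRow (linkedMatrix A) x ↔ ∃ k, x = .inr k := by
  constructor
  · rintro ⟨x', hne, h⟩
    rcases x with (i | i) | i
    · rcases x' with (j | j) | j
      · have := h (.inl (.inr i)); simp_all [linkedMatrix]
      · have := h (.inr 0); simp_all [linkedMatrix]
      · have := h (.inr 0); simp_all [linkedMatrix]
    · rcases x' with (j | j) | j
      · have := h (.inr 0); simp_all [linkedMatrix]
      · have := h (.inl (.inr i)); simp_all [linkedMatrix]
      · have := h (.inl (.inr i)); simp_all [linkedMatrix]
    · exact ⟨i, rfl⟩
  · rintro ⟨k, rfl⟩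
    refine ⟨.inr (k + 1), by fin_cases k <;> simp, ?_⟩
    rintro ((j | j) | j) <;> simp [linkedMatrix]

/-- By transposition the repeated columns are the special ones, and their ones lie exactly in the
first block. -/
theorem isMarkedRow_linkedMatrix (A : α → α → Bool) (x : (α ⊕ α) ⊕ Fin 2) :
    IsMarkedRow (linkedMatrix A) x ↔ ∃ i, x = .inl (.inl i) := by
  have h : (fun y x => linkedMatrix A x y) = linkedMatrix fun i j => A j i :=
    funext fun y => funext fun x => linkedMatrix_transpose A x y
  simp only [IsMarkedRow, h, isTwinRow_linkedMatrix]
  rcases x with (i | i) | i <;> simp [linkedMatrix]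

theorem isSecondRow_linkedMatrix (A : α → α → Bool) (x : (α ⊕ α) ⊕ Fin 2) :
    (¬ IsTwinRow (linkedMatrix A) x ∧ ¬ IsMarkedRow (linkedMatrix A) x) ↔
      ∃ i, x = .inl (.inr i) := by
  rw [isTwinRow_linkedMatrix, isMarkedRow_linkedMatrix]
  rcases x with (i | i) | i <;> simp

theorem exists_equiv_blocks {A : α → α → Bool} {B : α' → α' → Bool}
    (γ₁ γ₂ : (α' ⊕ α') ⊕ Fin 2 ≃ (α ⊕ α) ⊕ Fin 2)
    (h : ∀ x y, linkedMatrix A (γ₁ x) (γ₂ y) = linkedMatrix B x y) :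
    ∃ p q : α' ≃ α, (∀ i, γ₁ (.inl (.inl i)) = .inl (.inl (p i))) ∧
      ∀ i, γ₁ (.inl (.inr i)) = .inl (.inr (q i)) := by
  obtain ⟨p, hp⟩ := exists_equiv_of_range γ₁ (ι := fun i : α' => .inl (.inl i))
    (κ := fun i : α => .inl (.inl i)) (fun _ _ h => by simpa using h)
    (fun _ _ h => by simpa using h) fun x => by
      rw [← isMarkedRow_linkedMatrix A, ← isMarkedRow_linkedMatrix B,
        isMarkedRow_iff_of_equiv γ₁ γ₂ h]
  obtain ⟨q, hq⟩ := exists_equiv_of_range γ₁ (ι := fun i : α' => .inl (.inr i))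
    (κ := fun i : α => .inl (.inr i)) (fun _ _ h => by simpa using h)
    (fun _ _ h => by simpa using h) fun x => by
      rw [← isSecondRow_linkedMatrix A, ← isSecondRow_linkedMatrix B,
        isMarkedRow_iff_of_equiv γ₁ γ₂ h, isTwinRow_iff_of_equiv γ₁ γ₂ h]
  exact ⟨p, q, hp, hq⟩

theorem exists_relabelling_iff_exists_submatrix (A : α → α → Bool) (B : α' → α' → Bool) :
    (∃ g : α' ≃ α, ∀ i j, A (g i) (g j) = B i j) ↔
      ∃ γ₁ γ₂ : (α' ⊕ α') ⊕ Fin 2 ≃ (α ⊕ α) ⊕ Fin 2,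
        ∀ x y, linkedMatrix A (γ₁ x) (γ₂ y) = linkedMatrix B x y := by
  constructor
  · rintro ⟨g, h⟩
    refine ⟨Equiv.sumCongr (Equiv.sumCongr g g) (Equiv.refl _),
      Equiv.sumCongr (Equiv.sumCongr g g) (Equiv.refl _), ?_⟩
    rintro ((i | i) | i) ((j | j) | j) <;> simp [linkedMatrix, h]
  · rintro ⟨γ₁, γ₂, h⟩
    obtain ⟨p, q, hp, hq⟩ := exists_equiv_blocks γ₁ γ₂ h
    obtain ⟨r, s, hr, hs⟩ := exists_equiv_blocks (A := fun i j => A j i) (B := fun i j => B j i)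
      γ₂ γ₁ fun y x => by rw [← linkedMatrix_transpose A, ← linkedMatrix_transpose B, h]
    -- Each of the three identity blocks equates the permutation of its rows with that of its
    -- columns. The chain `p = s = q = r` makes the row and column permutations of the block `A`
    -- equal.
    have h₁ : ∀ i, p i = s i := fun i => by
      simpa [hp, hs, linkedMatrix] using h (.inl (.inl i)) (.inl (.inr i))
    have h₂ : ∀ i, q i = s i := fun i => by
      simpa [hq, hs, linkedMatrix] using h (.inl (.inr i)) (.inl (.inr i))
    have h₃ : ∀ i, q i = r i := fun i => by
      simpa [hq, hr, linkedMatrix] using h (.inl (.inr i)) (.inl (.inl i))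
    refine ⟨p, fun i j => ?_⟩
    have h₄ := h (.inl (.inl i)) (.inl (.inl j))
    rw [hp, hr, ← h₃, h₂, ← h₁] at h₄
    exact h₄

end

/-- The entries of the adjacency matrix of a graph. -/
noncomputable def FiniteGraph.adj (G : FiniteGraph) : Fin G.order → Fin G.order → Bool :=
  G.adjacency.entry

theorem FiniteGraph.adj_eq_adj_iff {G H : FiniteGraph} {i j : Fin G.order} {k l : Fin H.order} :
    G.adj i j = H.adj k l ↔ (G.graph.Adj i j ↔ H.graph.Adj k l) :=
  decide_eq_decide

/-- The square matrix of a graph, with its rows and columns numbered. -/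
noncomputable def graphCube (G : FiniteGraph) : Cube2 :=
  blockCube (linkedMatrix G.adj)

theorem similar_blockCube_iff {m n k m' n' k' : ℕ}
    (W : (Fin m ⊕ Fin n) ⊕ Fin k → (Fin m ⊕ Fin n) ⊕ Fin k → Bool)
    (W' : (Fin m' ⊕ Fin n') ⊕ Fin k' → (Fin m' ⊕ Fin n') ⊕ Fin k' → Bool) :
    (blockCube W).Similar (blockCube W') ↔
      ∃ γ₁ γ₂ : (Fin m' ⊕ Fin n') ⊕ Fin k' ≃ (Fin m ⊕ Fin n) ⊕ Fin k,
        ∀ x y, W (γ₁ x) (γ₂ y) = W' x y := by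
  let e := blockEquiv m n k
  let e' := blockEquiv m' n' k'
  constructor
  · rintro ⟨γ₁, γ₂, h⟩
    refine ⟨(e'.symm.trans γ₁).trans e, (e'.symm.trans γ₂).trans e, fun x y => ?_⟩
    have := congrFun (congrFun h (e'.symm x)) (e'.symm y)
    change W (e (γ₁ _)) (e (γ₂ _)) = W' (e' _) (e' _) at this
    rwa [e'.apply_symm_apply, e'.apply_symm_apply] at this
  · rintro ⟨γ₁, γ₂, h⟩
    refine ⟨(e'.trans γ₁).trans e.symm, (e'.trans γ₂).trans e.symm, ?_⟩
    funext x y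
    change W (e (e.symm _)) (e (e.symm _)) = W' (e' x) (e' y)
    rw [e.apply_symm_apply, e.apply_symm_apply]
    exact h (e' x) (e' y)

theorem nonempty_iso_iff_similar (G H : FiniteGraph) :
    Nonempty (G.graph ≃g H.graph) ↔ (graphCube G).Similar (graphCube H) := by
  rw [graphCube, graphCube, similar_blockCube_iff, ← exists_relabelling_iff_exists_submatrix]
  constructor
  · rintro ⟨φ⟩
    exact ⟨φ.symm.toEquiv, fun i j => FiniteGraph.adj_eq_adj_iff.2 φ.symm.map_adj_iff⟩
  · rintro ⟨g, h⟩
    exact ⟨RelIso.symm ⟨g, fun {i j} => FiniteGraph.adj_eq_adj_iff.1 (h i j)⟩⟩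

/-! ### The reductions -/

/-- The program consumes the input `v` and writes the reverse of `w`, in cubic time. -/
def Rewrites (p : StackProg Reg (Option Bool)) (c : ℕ) (v w : List (Option Bool)) : Prop :=
  -- The term `2 * w.length` pays for moving the output back to the input stack. Arbitrary `i` and
  -- `o` allow a second run after the first.
  ∃ t, t + 2 * w.length ≤ c * (v.length + 1) ^ 3 ∧ ∀ i o,
    Runs p (Reg.mk (v ++ i) o [] [] [] [] [] []) (Reg.mk i (w.reverse ++ o) [] [] [] [] [] []) t

/-- A program that rewrites words yields a machine that rewrites pairs of words. -/
theorem nonempty_computable_of_rewrites {I J : Type} {ea : I → List (Option Bool)}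
    {eb : J → List (Option Bool)} {f : I → J} (p : StackProg Reg (Option Bool)) (c : ℕ)
    (h : ∀ x, ∃ v₁ v₂ w₁ w₂, ea x = v₁ ++ v₂ ∧ eb (f x) = w₁ ++ w₂ ∧ Rewrites p c v₁ w₁ ∧
      Rewrites p c v₂ w₂) : Nonempty (Turing.TM2ComputableInPolyTime ea eb f) := by
  refine nonempty_computableInPolyTime (seq p (seq p (move out inp))) inp
    (Polynomial.C (2 * c) * (Polynomial.X + 1) ^ 3 + 1) fun x => ?_
  obtain ⟨v₁, v₂, w₁, w₂, hv, hw, ⟨t₁, ht₁, h₁⟩, ⟨t₂, ht₂, h₂⟩⟩ := h x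
  rw [hv, hw, Reg.update_empty_inp, Reg.update_empty_inp]
  -- The second run pushes on top of the first output; the final move reverses both words into the
  -- right order.
  have h₂' := h₂ [] (w₁.reverse ++ [])
  rw [List.append_nil v₂] at h₂'
  refine ((h₁ v₂ []).seq (h₂'.seq (runs_move (by decide) _))).congr (by simp) ?_
  have e₁ : c * (v₁.length + 1) ^ 3 ≤ c * (v₁.length + v₂.length + 1) ^ 3 := by gcongr; omega
  have e₂ : c * (v₂.length + 1) ^ 3 ≤ c * (v₁.length + v₂.length + 1) ^ 3 := by gcongr; omega
  simp
  linarith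

theorem length_encode (C : Cube2) :
    C.encode.length = C.rows + C.cols + 2 + C.rows * (C.cols + 1) := by
  have h : (List.ofFn fun i => Cube2.encodeRow (C.entry i)).flatten.length = _ :=
    length_encodeRows C.entry
  simp only [Cube2.encode, List.length_append, List.length_cons, List.length_replicate, h]
  ring

theorem rewrites_writeGraph (C : Cube2) :
    Rewrites writeGraph 1000 C.encode (cubeGraph C).adjacency.encode := by
  rw [adjacency_cubeGraph]
  refine ⟨_, ?_, runs_writeGraph C⟩
  -- Unary dimensions bound both sides by the length of the code, even if the matrix has no entries.
  have hm : C.rows ≤ C.encode.length := by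
    rw [length_encode]; linarith [Nat.zero_le (C.rows * (C.cols + 1))]
  have hn : C.cols ≤ C.encode.length := by
    rw [length_encode]; linarith [Nat.zero_le (C.rows * (C.cols + 1))]
  rw [length_encode (blockCube _)]
  simp only [blockCube]
  generalize C.rows = m at *
  generalize C.cols = n at *
  generalize C.encode.length = L at *
  calc _ ≤ L * (10 * L + 5 * L + 30) + L * (L * (4 * L + 10) + 5 * L + 20) + 40 * L + 40 * L +
        200 + 2 * (L + L + 3 + (L + L + 3) + 2 + (L + L + 3) * (L + L + 3 + 1)) := by gcongr
    _ ≤ _ := by nlinarith [Nat.zero_le L, Nat.zero_le (L ^ 2), Nat.zero_le (L ^ 3)]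

theorem rewrites_writeLinkedMatrix (G : FiniteGraph) :
    Rewrites writeLinkedMatrix 1000 G.adjacency.encode (graphCube G).encode := by
  refine ⟨_, ?_, runs_writeLinkedMatrix G.adj⟩
  have hn : G.order ≤ G.adjacency.encode.length := by
    rw [length_encode]
    have : G.adjacency.rows = G.order := rfl
    have := Nat.zero_le (G.adjacency.rows * (G.adjacency.cols + 1))
    omega
  rw [length_encode (graphCube G)]
  simp only [blockCube, graphCube]
  generalize G.order = n at *
  generalize G.adjacency.encode.length = L at *
  calc _ ≤ L * (17 * L + 150) + 200 + 2 * (L + L + 2 + (L + L + 2) + 2 +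
        (L + L + 2) * (L + L + 2 + 1)) := by gcongr
    _ ≤ _ := by nlinarith [Nat.zero_le L, Nat.zero_le (L ^ 2), Nat.zero_le (L ^ 3)]

theorem cubeSimilarity2_reducible : cubeSimilarity2.PolyTimeReducible graphIsomorphism :=
  ⟨fun x => (cubeGraph x.1, cubeGraph x.2), fun x => similar_iff_nonempty_iso x.1 x.2,
    nonempty_computable_of_rewrites writeGraph 1000 fun x =>
      ⟨_, _, _, _, rfl, rfl, rewrites_writeGraph x.1, rewrites_writeGraph x.2⟩⟩

theorem reducible_cubeSimilarity2 : graphIsomorphism.PolyTimeReducible cubeSimilarity2 :=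
  ⟨fun x => (graphCube x.1, graphCube x.2), fun x => nonempty_iso_iff_similar x.1 x.2,
    nonempty_computable_of_rewrites writeLinkedMatrix 1000 fun x =>
      ⟨_, _, _, _, rfl, rfl, rewrites_writeLinkedMatrix x.1, rewrites_writeLinkedMatrix x.2⟩⟩

/-- Restricting a problem keeps its encoding, so the same program works. -/
theorem regularCubeSimilarity2_reducible :
    regularCubeSimilarity2.PolyTimeReducible graphIsomorphism :=
  ⟨fun x => (cubeGraph x.1.1, cubeGraph x.1.2), fun x => similar_iff_nonempty_iso x.1.1 x.1.2,
    nonempty_computable_of_rewrites writeGraph 1000 fun x =>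
      ⟨_, _, _, _, rfl, rfl, rewrites_writeGraph x.1.1, rewrites_writeGraph x.1.2⟩⟩

theorem reducible_regularCubeSimilarity2 :
    graphIsomorphism.PolyTimeReducible regularCubeSimilarity2 :=
  ⟨fun x => ⟨(graphCube x.1, graphCube x.2), rfl, rfl⟩,
    fun x => nonempty_iso_iff_similar x.1 x.2,
    nonempty_computable_of_rewrites writeLinkedMatrix 1000 fun x =>
      ⟨_, _, _, _, rfl, rfl, rewrites_writeLinkedMatrix x.1, rewrites_writeLinkedMatrix x.2⟩⟩

theorem mainTheorem2 :
    GraphIsomorphismComplete cubeSimilarity2 ∧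
      GraphIsomorphismComplete regularCubeSimilarity2 := by
  exact ⟨⟨cubeSimilarity2_reducible, reducible_cubeSimilarity2⟩,
    ⟨regularCubeSimilarity2_reducible, reducible_regularCubeSimilarity2⟩⟩
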